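/- Let $(\Omega,\mathcal F,\mathbb P)$ be a probability space carrying a Poisson process $N$ with intensity $\lambda>0$ and jump times $T_1,T_2,\dots$, and i.i.d. claim sizes $Y_1,Y_2,\dots$, independent of $N$, with a continuous distribution function $F_Y$ such that $F_Y(0)=0$, and with $\mathbb E[Y_1^2]<\infty$. Let $Z_t=\sum_{j=1}^{N_t}Y_j$ and let $(\mathcal F^Z_t)_{t\ge 0}$ be its natural filtration. Let $T>0$ be the maturity, $\mathcal S>0$ a waiting time, $m_1,m_2\ge 0$ deductibles, $c\in\mathbb R$ an income rate, and let the premium rates $s\mapsto\pi_i(s,m_i)$, $i\in\{1,2\}$, be measurable with $0\le\pi_i(s,m_i)<c$ for all $s\ge 0$. Let $h:\mathbb R\to\mathbb R$ be Lipschitz continuous. An admissible barrier strategy is an $(\mathcal F^Z_t)$-predictable process $b=(b_u)$ with values in $[0,\infty)$; $\mathcal B(t)$ denotes the set of such strategies on $[t,T]$. Given $b\in\mathcal B(t)$ and an initial state $(I_t,S_t,X_t)=(i,s,x)$, consisting of the class, the time since the last report and the wealth, the controlled process $(I_u,S_u,X_u)_{t\le u\le T}$ evolves as follows. Between claims, $\mathrm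 dS_u=\mathrm du$ and $\mathrm dX_u=(c-\pi_{I_u}(S_u,m_{I_u}))\,\mathrm du$, with $I$ constant, except that whenever $I=2$ and $S$ reaches (or starts at) $\mathcal S$, the state $(2,\mathcal S,X)$ is replaced at once by $(1,0,X)$. At a claim time $u=T_j\in(t,T]$ with size $Y_j$: if $Y_j\le b_u$, the claim is not reported and $X$ decreases by $Y_j$, while $I$ and $S$ do not change; if $Y_j>b_u$, the claim is reported, $X$ decreases by $\min(Y_j,m_{I_{u-}})$, and $(I_u,S_u)=(2,0)$. Let $$D_1=\{(t,s,x): 0\le s\le t\le T,\ x\in\mathbb R\},\qquad D_2=\{(t,s,x)\in D_1: s\le\mathcal S\},$$ and for $i\in\{1,2\}$ and $(t,s,x)\in D_i$ let $$V(i,t,s,x)=\sup_{b\in\mathcal B(t)}\mathbb E_{i,t,s,x}\big[h(X_T)\big],$$ where $\mathbb E_{i,t,s,x}$ means that the controlled process starts at time $t$ in the state $(i,s,x)$. Then all these expectations exist, the supremum is finite, and for each $i\in\{1,2\}$ the map $(t,s,x)\mapsto V(i,t,s,x)$ is Lipschitz continuous on $D_i$, jointly in its three variables. -/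

import Mathlib

open MeasureTheory ProbabilityTheory Set
open scoped NNReal

namespace BonusMalus

/-! ### The claim process -/

section Claims

variable {Ω : Type*} [MeasurableSpace Ω]

/-- `N` is a (homogeneous) Poisson process with intensity `rate`: a counting process started at
`0` with nondecreasing right-continuous paths and independent, Poisson distributed increments.
The topology on `ℕ` is discrete. -/
structure IsPoissonProcess (N : ℝ≥0 → Ω → ℕ) (rate : ℝ≥0) (P : Measure Ω) : Prop where
  measurable : ∀ t, Measurable (N t)
  zero : ∀ ω, N 0 ω = 0
  mono : ∀ ω, Monotone fun t => N t ω
  rightCts : ∀ ω t, ContinuousWithinAt (fun u => N u ω) (Ici t) t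
  indepIncrements : HasIndepIncrements N P
  law : ∀ s t, s ≤ t → P.map (fun ω => N t ω - N s ω) = poissonMeasure (rate * (t - s))

/-- The claim arrivals `N` form a Poisson process, and the claim sizes `Y` are i.i.d., independent
of `N`, with a continuous distribution function that vanishes at `0` and with finite second
moment. The claims are numbered from `0`. -/
structure IsClaimModel (N : ℝ≥0 → Ω → ℕ) (Y : ℕ → Ω → ℝ) (rate : ℝ≥0) (P : Measure Ω) :
    Prop where
  poisson : IsPoissonProcess N rate P
  measurable_size : ∀ j, Measurable (Y j)
  indep_size : iIndepFun Y P
  identDistrib_size : ∀ j, IdentDistrib (Y j) (Y 0) P P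
  continuous_cdf : Continuous (cdf (P.map (Y 0)))
  cdf_zero : cdf (P.map (Y 0)) 0 = 0
  secondMoment : Integrable (fun ω => Y 0 ω ^ 2) P
  indep : IndepFun (fun ω j => Y j ω) (fun ω t => N t ω) P

/-- The time of the claim with number `j` (numbered from `0`). It is only used for claims that do
occur, that is, when the set is nonempty. -/
noncomputable def claimTime (N : ℝ≥0 → Ω → ℕ) (j : ℕ) (ω : Ω) : ℝ≥0 :=
  sInf {u : ℝ≥0 | j < N u ω}

/-- The compound Poisson process of aggregated claims. -/
noncomputable def aggregateClaims (N : ℝ≥0 → Ω → ℕ) (Y : ℕ → Ω → ℝ) (t : ℝ≥0) (ω : Ω) : ℝ :=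
  ∑ j ∈ Finset.range (N t ω), Y j ω

theorem measurable_aggregateClaims {N : ℝ≥0 → Ω → ℕ} {Y : ℕ → Ω → ℝ}
    (hN : ∀ t, Measurable (N t)) (hY : ∀ j, Measurable (Y j)) (t : ℝ≥0) :
    Measurable (aggregateClaims N Y t) := by
  have h : Measurable fun p : Ω × ℕ => ∑ j ∈ Finset.range p.2, Y j p.1 :=
    measurable_from_prod_countable_left fun n =>
      Finset.measurable_fun_sum (Finset.range n) fun j _ => hY j
  exact h.comp (measurable_id.prodMk (hN t))

/-- The natural filtration of the aggregated claims. -/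
noncomputable def claimFiltration {N : ℝ≥0 → Ω → ℕ} {Y : ℕ → Ω → ℝ} {rate : ℝ≥0} {P : Measure Ω}
    (hM : IsClaimModel N Y rate P) : Filtration ℝ≥0 ‹MeasurableSpace Ω› :=
  Filtration.natural (aggregateClaims N Y) fun t =>
    (measurable_aggregateClaims hM.poisson.measurable hM.measurable_size t).stronglyMeasurable

/-- The admissible barrier strategies: nonnegative processes that are predictable with respect to
the natural filtration of the aggregated claims. A strategy on `[t, T]` is the restriction of such
a process, and the wealth of a policyholder observed from `t` to `T` depends on no other values. -/
def barrierStrategies {N : ℝ≥0 → Ω → ℕ} {Y : ℕ → Ω → ℝ} {rate : ℝ≥0} {P : Measure Ω}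
    (hM : IsClaimModel N Y rate P) : Set (ℝ≥0 → Ω → ℝ≥0) :=
  {b | IsStronglyPredictable (claimFiltration hM) b}

end Claims

/-! ### The contract and the controlled process -/

/-- The two insurance classes. -/
inductive InsClass
  | C1
  | C2

/-- The data of the contract: income rate, premium rates `premium i s m` (class, time since the
last report, deductible), the deductible of each class, and the time without a report after which
the policyholder leaves class 2. -/
structure Contract where
  income : ℝ
  premium : InsClass → ℝ → ℝ → ℝ
  deductible : InsClass → ℝ
  waiting : ℝ

/-- A state `(I, S, X)` of the policyholder: class, time since the last report, wealth. -/
structure State where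
  cls : InsClass
  dur : ℝ
  wealth : ℝ

namespace Contract

variable (C : Contract)

/-- The rate at which wealth changes between claims. -/
def drift (i : InsClass) (s : ℝ) : ℝ := C.income - C.premium i s (C.deductible i)

/-- The evolution over a time span `d` in which no claim occurs. In class 2 the policyholder moves
to class 1, and the clock is reset to zero, at the moment when the clock reaches `waiting`. -/
noncomputable def flow (d : ℝ) : State → State
  | ⟨.C1, s, x⟩ => ⟨.C1, s + d, x + ∫ v in s..(s + d), C.drift .C1 v⟩
  | ⟨.C2, s, x⟩ =>
    if s + d < C.waiting then
      ⟨.C2, s + d, x + ∫ v in s..(s + d), C.drift .C2 v⟩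
    else
      ⟨.C1, s + d - C.waiting,
        x + (∫ v in s..C.waiting, C.drift .C2 v)
          + ∫ v in (0 : ℝ)..(s + d - C.waiting), C.drift .C1 v⟩

/-- The effect of a claim of size `y` under the barrier `β`: a claim `y ≤ β` is not reported and
paid by the policyholder; a claim `y > β` is reported, which costs `min y m` with the deductible
`m` of the current class, and puts the policyholder at the start of class 2. -/
noncomputable def claim (z : State) (y β : ℝ) : State :=
  if y ≤ β then ⟨z.cls, z.dur, z.wealth - y⟩
  else ⟨.C2, 0, z.wealth - min y (C.deductible z.cls)⟩

/-- The claims with numbers `n₀, n₀ + 1, …` hit a policyholder who is in state `z` at time `t`;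
claim `j` has time `τ j` and size `y j`, and `β` is the barrier. The value at `k` is the time of
the `k`-th of these claims and the state right after it (for `k = 0`: the pair `(t, z)`). -/
noncomputable def afterClaims (τ : ℕ → ℝ≥0) (y : ℕ → ℝ) (β : ℝ≥0 → ℝ≥0) (n₀ : ℕ)
    (t : ℝ≥0) (z : State) : ℕ → ℝ≥0 × State
  | 0 => (t, z)
  | k + 1 =>
    let p := afterClaims τ y β n₀ t z k
    let r := τ (n₀ + k)
    (r, C.claim (C.flow ((r : ℝ) - p.1) p.2) (y (n₀ + k)) (β r))

variable {Ω : Type*} [MeasurableSpace Ω]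

/-- The controlled process `(I_u, S_u, X_u)`, `u ≥ t`, started at time `t` in state `z`: the claims
that occur in `(t, u]` are applied in turn, with the claim-free evolution in between and after. -/
noncomputable def controlledState (N : ℝ≥0 → Ω → ℕ) (Y : ℕ → Ω → ℝ) (b : ℝ≥0 → Ω → ℝ≥0)
    (t : ℝ≥0) (z : State) (u : ℝ≥0) (ω : Ω) : State :=
  let p := C.afterClaims (fun j => claimTime N j ω) (fun j => Y j ω) (fun v => b v ω) (N t ω) t z
    (N u ω - N t ω)
  C.flow ((u : ℝ) - p.1) p.2

/-- The wealth `X_T` at maturity of a policyholder who is in state `(i, s, x)` at time `t`. -/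
noncomputable def terminalWealth (N : ℝ≥0 → Ω → ℕ) (Y : ℕ → Ω → ℝ) (T : ℝ≥0)
    (i : InsClass) (t : ℝ≥0) (s x : ℝ) (b : ℝ≥0 → Ω → ℝ≥0) (ω : Ω) : ℝ :=
  (C.controlledState N Y b t ⟨i, s, x⟩ T ω).wealth

/-- The functional `J(i, t, s, x, b) = E_{i,t,s,x}[h(X_T)]`. -/
noncomputable def payoff (P : Measure Ω) (N : ℝ≥0 → Ω → ℕ) (Y : ℕ → Ω → ℝ) (T : ℝ≥0) (h : ℝ → ℝ)
    (i : InsClass) (t : ℝ≥0) (s x : ℝ) (b : ℝ≥0 → Ω → ℝ≥0) : ℝ :=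
  ∫ ω, h (C.terminalWealth N Y T i t s x b ω) ∂P

/-- The value function `V(i, t, s, x)`, the supremum of `J` over the barrier strategies. -/
noncomputable def value {P : Measure Ω} {N : ℝ≥0 → Ω → ℕ} {Y : ℕ → Ω → ℝ} {rate : ℝ≥0}
    (hM : IsClaimModel N Y rate P) (T : ℝ≥0) (h : ℝ → ℝ)
    (i : InsClass) (t : ℝ≥0) (s x : ℝ) : ℝ :=
  sSup (C.payoff P N Y T h i t s x '' barrierStrategies hM)

/-- The domain of `(t, s, x) ↦ V(i, t, s, x)`: `0 ≤ s ≤ t ≤ T`, and `s ≤ waiting` in class 2. -/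
def domain (T : ℝ≥0) (i : InsClass) : Set (ℝ≥0 × ℝ × ℝ) :=
  {p | 0 ≤ p.2.1 ∧ p.2.1 ≤ p.1 ∧ p.1 ≤ T ∧ (i = .C2 → p.2.1 ≤ C.waiting)}

end Contract

end BonusMalus

/-! Fix one barrier strategy and let two policyholders with different initial data face the same
claims. A barrier is a function of time and scenario, not of the state, so both report exactly the
same claims. Before the first report the difference of their clocks is frozen; that report sends
both to the start of class 2, and from then on their classes and clocks agree and their wealth gap
no longer changes.

In coordinates that are constant between claims (`flow_eq_lineState`), with θ the time at which the
clock coordinate vanishes, the gap can grow only at the first report: by at most `income * |θ - θ'|`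
through the premiums, and by a deductible difference if the two are then in different classes
(`lineAfter_dist_le`). The latter is a jump, but it needs a claim between θ and θ'
(`one_le_card_of_crossing`), and the expected number of such claims is of order `rate * |θ - θ'|`.
The Poisson arrivals thus smooth the discontinuity at the class change.

Moving the initial time from `t` to `t'` with fixed coordinates matters only if a claim falls in
`(t, t']`; the effect is dominated by a sum over these claims (`abs_lineWealth_sub_le_of_le`), whose
mean is a multiple of `t' - t` by Wald's identity.

All bounds are uniform in the strategy, and the set of strategies is the same for all initial data,
so they pass to the suprema (`abs_sSup_image_sub_le`). -/

namespace BonusMalus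

/-! ### Straightened coordinates

Both classes lie on one line: class 1 with clock `s` has coordinate `σ = s`, class 2 with clock `s`
has coordinate `σ = s - waiting`, and `σ` grows at unit speed between claims. With a primitive `G`
of the drift along this line, the pair `(u - σ, X - G σ)`, where `u` is the current time, does not
change between claims. -/

namespace Contract

variable (C : Contract)

/-- The drift along the line of clock coordinates, set to zero outside of the state space. -/
noncomputable def lineDrift (v : ℝ) : ℝ :=
  if v ≤ -C.waiting then 0 else if v ≤ 0 then C.drift .C2 (v + C.waiting) else C.drift .C1 v

/-- The primitive of `lineDrift` that vanishes at `0`. -/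
noncomputable def lineGain (σ : ℝ) : ℝ := ∫ v in (0 : ℝ)..σ, C.lineDrift v

/-- The class at a point of the line. -/
noncomputable def lineClass (σ : ℝ) : InsClass := if σ < 0 then .C2 else .C1

/-- The state with clock coordinate `σ` and reduced wealth `w`. -/
noncomputable def lineState (σ w : ℝ) : State :=
  if σ < 0 then ⟨.C2, σ + C.waiting, w + C.lineGain σ⟩ else ⟨.C1, σ, w + C.lineGain σ⟩

/-- The clock coordinate of class `i` and clock `s`. -/
def lineCoord (i : InsClass) (s : ℝ) : ℝ :=
  match i with
  | .C1 => s
  | .C2 => s - C.waiting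

theorem lineState_of_neg {σ : ℝ} (hσ : σ < 0) (w : ℝ) :
    C.lineState σ w = ⟨.C2, σ + C.waiting, w + C.lineGain σ⟩ := if_pos hσ

theorem lineState_of_nonneg {σ : ℝ} (hσ : 0 ≤ σ) (w : ℝ) :
    C.lineState σ w = ⟨.C1, σ, w + C.lineGain σ⟩ := if_neg hσ.not_gt

theorem lineState_wealth (σ w : ℝ) : (C.lineState σ w).wealth = w + C.lineGain σ := by
  unfold lineState
  split_ifs <;> rfl

theorem lineCoord_C1 (s : ℝ) : C.lineCoord .C1 s = s := rfl

theorem lineCoord_C2 (s : ℝ) : C.lineCoord .C2 s = s - C.waiting := rfl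

/-- The effect of a claim of size `y` at time `r` on the straightened coordinates. -/
noncomputable def lineClaim (r y β : ℝ) (q : ℝ × ℝ) : ℝ × ℝ :=
  if y ≤ β then (q.1, q.2 - y)
  -- A report puts the clock coordinate at `-waiting`, so it will vanish at time `r + waiting`; the
  -- wealth is reduced anew relative to this coordinate.
  else (r + C.waiting,
    q.2 + C.lineGain (r - q.1) - C.lineGain (-C.waiting)
      - min y (C.deductible (lineClass (r - q.1))))

/-- The straightened coordinates after the `k` claims with numbers `n, …, n + k - 1`. -/
noncomputable def lineAfter (r y β : ℕ → ℝ) (n : ℕ) (q : ℝ × ℝ) : ℕ → ℝ × ℝ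
  | 0 => q
  | k + 1 => C.lineClaim (r (n + k)) (y (n + k)) (β (n + k)) (lineAfter r y β n q k)

theorem lineAfter_add (r y β : ℕ → ℝ) (n : ℕ) (q : ℝ × ℝ) (k l : ℕ) :
    C.lineAfter r y β n q (k + l) = C.lineAfter r y β (n + k) (C.lineAfter r y β n q k) l := by
  induction l with
  | zero => rfl
  | succ l ih =>
    rw [← add_assoc]
    simp only [lineAfter, ih, add_assoc]

/-! #### The drift and its primitive -/

section Gain

variable {C}
variable (hwaiting : 0 < C.waiting)
  (hmeas : ∀ i, Measurable fun s => C.premium i s (C.deductible i))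
  (hnonneg : ∀ i s, 0 ≤ s → 0 ≤ C.premium i s (C.deductible i))
  (hincome : ∀ i s, 0 ≤ s → C.premium i s (C.deductible i) < C.income)

include hnonneg hincome in
theorem income_pos : 0 < C.income :=
  (hnonneg .C1 0 le_rfl).trans_lt (hincome .C1 0 le_rfl)

include hnonneg hincome in
theorem abs_lineDrift_le (v : ℝ) : |C.lineDrift v| ≤ C.income := by
  have h0 := income_pos hnonneg hincome
  have key : ∀ i s, 0 ≤ s → |C.drift i s| ≤ C.income := fun i s hs => by
    have h1 := hnonneg i s hs
    have h2 := hincome i s hs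
    rw [drift, abs_le]
    constructor <;> linarith
  unfold lineDrift
  split_ifs with h1 h2
  · simpa using h0.le
  · exact key _ _ (by linarith)
  · exact key _ _ (by linarith)

include hmeas in
theorem measurable_lineDrift : Measurable C.lineDrift := by
  have hd : ∀ i, Measurable (C.drift i) := fun i => (hmeas i).const_sub C.income
  exact Measurable.ite measurableSet_Iic measurable_const
    (Measurable.ite measurableSet_Iic ((hd .C2).comp (measurable_id.add_const _)) (hd .C1))

include hmeas hnonneg hincome in
theorem intervalIntegrable_lineDrift (a b : ℝ) : IntervalIntegrable C.lineDrift volume a b := by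
  refine IntervalIntegrable.mono_fun (f := fun _ => C.income) intervalIntegrable_const
    (measurable_lineDrift hmeas).aestronglyMeasurable (Filter.Eventually.of_forall fun v => ?_)
  simpa using (abs_lineDrift_le hnonneg hincome v).trans (le_abs_self _)

include hmeas hnonneg hincome in
theorem lineGain_sub (a b : ℝ) :
    C.lineGain b - C.lineGain a = ∫ v in a..b, C.lineDrift v :=
  intervalIntegral.integral_interval_sub_left
    (intervalIntegrable_lineDrift hmeas hnonneg hincome 0 b)
    (intervalIntegrable_lineDrift hmeas hnonneg hincome 0 a)

include hmeas hnonneg hincome in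
-- The premium rates enter the comparison of paths only through this bound, so no regularity beyond
-- measurability is needed.
theorem abs_lineGain_sub_le (a b : ℝ) :
    |C.lineGain b - C.lineGain a| ≤ C.income * |b - a| := by
  rw [lineGain_sub hmeas hnonneg hincome]
  exact intervalIntegral.norm_integral_le_of_norm_le_const (f := C.lineDrift)
    fun v _ => (Real.norm_eq_abs _).trans_le (abs_lineDrift_le hnonneg hincome v)

include hmeas hnonneg hincome in
theorem measurable_lineGain : Measurable C.lineGain := by
  refine (LipschitzWith.of_dist_le_mul (K := C.income.toNNReal) fun a b => ?_).continuous.measurable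
  rw [Real.dist_eq, Real.dist_eq, Real.coe_toNNReal _ (income_pos hnonneg hincome).le]
  exact abs_lineGain_sub_le hmeas hnonneg hincome b a

include hwaiting in
theorem integral_drift_C1 {a b : ℝ} (ha : 0 ≤ a) (hab : a ≤ b) :
    ∫ v in a..b, C.drift .C1 v = ∫ v in a..b, C.lineDrift v := by
  -- At `v = 0` the line carries the drift of class 2, so agreement holds only in the interior.
  refine intervalIntegral.integral_congr_Ioo_of_le hab fun v hv => ?_
  have : 0 < v := ha.trans_lt hv.1
  simp only [lineDrift]
  rw [if_neg (by linarith), if_neg (by linarith)]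

theorem integral_drift_C2 {a b : ℝ} (ha : 0 ≤ a) (hab : a ≤ b) (hb : b ≤ C.waiting) :
    ∫ v in a..b, C.drift .C2 v =
      ∫ v in (a - C.waiting)..(b - C.waiting), C.lineDrift v := by
  have h1 : ∫ v in (a - C.waiting)..(b - C.waiting), C.lineDrift v =
      ∫ v in (a - C.waiting)..(b - C.waiting), C.drift .C2 (v + C.waiting) := by
    refine intervalIntegral.integral_congr_Ioo_of_le (by linarith) fun v hv => ?_
    have h2 := hv.1
    have h3 := hv.2
    simp only [lineDrift]
    rw [if_neg (by linarith), if_pos (by linarith)]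
  rw [h1, intervalIntegral.integral_comp_add_right]
  simp

include hwaiting hmeas hnonneg hincome in
/-- Between claims, the reduced wealth is constant and the clock coordinate grows linearly. -/
theorem flow_eq_lineState {i : InsClass} {s d : ℝ} (x : ℝ) (hs : 0 ≤ s)
    (hi : i = .C2 → s ≤ C.waiting) (hd : 0 ≤ d) :
    C.flow d ⟨i, s, x⟩ =
      C.lineState (C.lineCoord i s + d) (x - C.lineGain (C.lineCoord i s)) := by
  cases i with
  | C1 =>
    rw [lineCoord_C1, lineState_of_nonneg _ (by linarith), flow, integral_drift_C1 hwaiting hs (by linarith),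
      ← lineGain_sub hmeas hnonneg hincome]
    congr 1
    ring
  | C2 =>
    have hsW := hi rfl
    rw [lineCoord_C2, flow]
    by_cases hlt : s + d < C.waiting
    · rw [if_pos hlt, lineState_of_neg _ (by linarith), integral_drift_C2 hs (by linarith) hlt.le,
        ← lineGain_sub hmeas hnonneg hincome, show s + d - C.waiting = s - C.waiting + d by ring]
      congr 1 <;> ring
    -- The class 2 integral ends and the class 1 integral begins at coordinate 0, where the values
    -- of `lineGain` cancel.
    · rw [if_neg hlt, lineState_of_nonneg _ (by linarith), integral_drift_C2 hs hsW le_rfl,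
        integral_drift_C1 hwaiting le_rfl (by linarith), ← lineGain_sub hmeas hnonneg hincome,
        ← lineGain_sub hmeas hnonneg hincome, sub_self,
        show s + d - C.waiting = s - C.waiting + d by ring]
      congr 1
      ring

include hwaiting hmeas hnonneg hincome in
theorem flow_lineState {σ d : ℝ} (w : ℝ) (hσ : -C.waiting ≤ σ) (hd : 0 ≤ d) :
    C.flow d (C.lineState σ w) = C.lineState (σ + d) w := by
  by_cases h : σ < 0
  · rw [lineState_of_neg _ h,
      flow_eq_lineState hwaiting hmeas hnonneg hincome _ (by linarith) (fun _ => by linarith) hd]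
    simp [lineCoord]
  · rw [lineState_of_nonneg _ (not_lt.1 h),
      flow_eq_lineState hwaiting hmeas hnonneg hincome _ (by linarith)
        (i := .C1) (fun h => InsClass.noConfusion h) hd]
    simp [lineCoord]

include hwaiting in
/-- A claim in straightened coordinates. -/
theorem claim_lineState (r y β : ℝ) (q : ℝ × ℝ) :
    C.claim (C.lineState (r - q.1) q.2) y β =
      C.lineState (r - (C.lineClaim r y β q).1) (C.lineClaim r y β q).2 := by
  have hcls : (C.lineState (r - q.1) q.2).cls = lineClass (r - q.1) := by
    unfold lineState lineClass
    split_ifs <;> rfl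
  unfold claim lineClaim
  by_cases h : y ≤ β
  · simp only [h, if_true]
    unfold lineState
    split_ifs
    · congr 1
      ring
    · congr 1
      ring
  · simp only [h, if_false, hcls, lineState_wealth]
    rw [lineState_of_neg _ (by linarith), show r - (r + C.waiting) = -C.waiting by ring]
    congr 1 <;> ring

/-! #### The path of the controlled process -/

include hwaiting hmeas hnonneg hincome in
/-- The controlled process in straightened coordinates. -/
theorem flow_afterClaims (τ : ℕ → ℝ≥0) (y : ℕ → ℝ) (β : ℝ≥0 → ℝ≥0) (n : ℕ) (t : ℝ≥0)
    {i : InsClass} {s : ℝ} (x : ℝ) (hs : 0 ≤ s) (hi : i = .C2 → s ≤ C.waiting) (k : ℕ)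
    (ht : ∀ j < k, t ≤ τ (n + j)) (hτ : ∀ j, j + 1 < k → τ (n + j) ≤ τ (n + (j + 1)))
    (u : ℝ) (hu : ((C.afterClaims τ y β n t ⟨i, s, x⟩ k).1 : ℝ) ≤ u) :
    let p := C.afterClaims τ y β n t ⟨i, s, x⟩ k
    let q := C.lineAfter (fun j => τ j) y (fun j => β (τ j)) n
      (t - C.lineCoord i s, x - C.lineGain (C.lineCoord i s)) k
    C.flow (u - p.1) p.2 = C.lineState (u - q.1) q.2 ∧ -C.waiting ≤ p.1 - q.1 := by
  induction k generalizing u with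
  | zero =>
    simp only [afterClaims, lineAfter] at hu ⊢
    constructor
    · rw [flow_eq_lineState hwaiting hmeas hnonneg hincome x hs hi (by linarith)]
      congr 1
      ring
    · cases i <;> simp only [lineCoord] <;> linarith
  | succ k ih =>
    have hprev : ((C.afterClaims τ y β n t ⟨i, s, x⟩ k).1 : ℝ) ≤ τ (n + k) := by
      cases k with
      | zero => exact_mod_cast ht 0 (by omega)
      | succ k => exact_mod_cast hτ k (by omega)
    obtain ⟨h1, h2⟩ := ih (fun j hj => ht j (by omega)) (fun j hj => hτ j (by omega)) _ hprev
    simp only [afterClaims] at hu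
    simp only [afterClaims, lineAfter]
    rw [h1, claim_lineState hwaiting]
    -- The clock coordinate never drops below `-waiting`: time only increases it, and a report sets
    -- it to exactly this value.
    have h3 : -C.waiting ≤ (τ (n + k) : ℝ) - (C.lineClaim (τ (n + k)) (y (n + k)) (β (τ (n + k)))
        (C.lineAfter (fun j => τ j) y (fun j => β (τ j)) n
          (t - C.lineCoord i s, x - C.lineGain (C.lineCoord i s)) k)).1 := by
      unfold lineClaim
      split_ifs
      · simp only
        linarith
      · simp
    refine ⟨?_, h3⟩
    rw [flow_lineState hwaiting hmeas hnonneg hincome _ h3 (by linarith)]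
    congr 1
    ring

/-! #### Pathwise estimates -/

include hmeas hnonneg hincome in
/-- Two paths under the same claims and barriers differ by at most their initial difference, plus
`κ` times the sum of the deductibles, where `κ ≥ 1` if some claim finds them in different classes. -/
theorem lineAfter_dist_le (hdeductible : ∀ i, 0 ≤ C.deductible i) {κ : ℝ} (hκ : 0 ≤ κ)
    (r y β : ℕ → ℝ) (n : ℕ) (q q' : ℝ × ℝ) (k : ℕ)
    (hcross : ∀ j < k, ¬(r (n + j) < q.1 ↔ r (n + j) < q'.1) → 1 ≤ κ) :
    |(C.lineAfter r y β n q k).2 - (C.lineAfter r y β n q' k).2|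
      + C.income * |(C.lineAfter r y β n q k).1 - (C.lineAfter r y β n q' k).1|
    ≤ |q.2 - q'.2| + C.income * |q.1 - q'.1|
      + (C.deductible .C1 + C.deductible .C2) * κ := by
  set D := C.deductible .C1 + C.deductible .C2 with hD
  have hc := income_pos hnonneg hincome
  have h1 := hdeductible .C1
  have h2 := hdeductible .C2
  have hDκ : 0 ≤ D * κ := by positivity
  have hmin : ∀ (v : ℝ) (i i' : InsClass),
      |min v (C.deductible i) - min v (C.deductible i')| ≤ D := by
    intro v i i'
    cases i <;> cases i' <;>
    rw [abs_le] <;>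
    constructor <;>
    rcases min_cases v (C.deductible .C1) with ⟨e, _⟩ | ⟨e, _⟩ <;>
    rcases min_cases v (C.deductible .C2) with ⟨e', _⟩ | ⟨e', _⟩ <;>
    linarith
  -- The induction needs a dichotomy: either nothing has been reported and all differences are the
  -- initial ones, or a report has merged the clocks and the wealth gap is bounded.
  suffices H : ((C.lineAfter r y β n q k).1 = q.1 ∧ (C.lineAfter r y β n q' k).1 = q'.1 ∧
      (C.lineAfter r y β n q k).2 - (C.lineAfter r y β n q' k).2 = q.2 - q'.2) ∨
      ((C.lineAfter r y β n q k).1 = (C.lineAfter r y β n q' k).1 ∧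
      |(C.lineAfter r y β n q k).2 - (C.lineAfter r y β n q' k).2| ≤
        |q.2 - q'.2| + C.income * |q.1 - q'.1| + D * κ) by
    rcases H with ⟨e1, e2, e3⟩ | ⟨e1, e2⟩
    · rw [e1, e2, e3]
      linarith
    · rw [e1, sub_self, abs_zero, mul_zero, add_zero]
      exact e2
  induction k with
  | zero => exact Or.inl ⟨rfl, rfl, rfl⟩
  | succ k ih =>
    specialize ih fun j hj => hcross j (by omega)
    have hcr := hcross k (by omega)
    simp only [lineAfter]
    generalize C.lineAfter r y β n q k = p at ih ⊢
    generalize C.lineAfter r y β n q' k = p' at ih ⊢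
    unfold lineClaim
    by_cases hy : y (n + k) ≤ β (n + k)
    · simp only [hy, if_true]
      rcases ih with ⟨e1, e2, e3⟩ | ⟨e1, e2⟩
      · exact Or.inl ⟨e1, e2, by linarith⟩
      · refine Or.inr ⟨e1, ?_⟩
        rwa [sub_sub_sub_cancel_right]
    · simp only [hy, if_false]
      refine Or.inr ⟨trivial, ?_⟩
      rcases ih with ⟨e1, e2, e3⟩ | ⟨e1, e2⟩
      -- The first report, the only claim at which the gap can change.
      · rw [e1, e2]
        have hG := abs_lineGain_sub_le hmeas hnonneg hincome (r (n + k) - q'.1) (r (n + k) - q.1)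
        rw [show r (n + k) - q.1 - (r (n + k) - q'.1) = -(q.1 - q'.1) by ring, abs_neg] at hG
        have hm : |min (y (n + k)) (C.deductible (lineClass (r (n + k) - q.1)))
            - min (y (n + k)) (C.deductible (lineClass (r (n + k) - q'.1)))| ≤ D * κ := by
          by_cases hx : r (n + k) < q.1 ↔ r (n + k) < q'.1
          · have : lineClass (r (n + k) - q.1) = lineClass (r (n + k) - q'.1) := by
              simp only [lineClass, sub_neg, hx]
            rw [this, sub_self, abs_zero]
            exact hDκ
          · exact (hmin _ _ _).trans (le_mul_of_one_le_right (by positivity) (hcr hx))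
        rw [← e3]
        rw [abs_le] at hG hm ⊢
        have := abs_le.1 (le_refl |p.2 - p'.2|)
        constructor <;> linarith
      -- A later report finds equal clocks, hence equal classes, and costs both the same.
      · rw [e1]
        convert e2 using 2
        ring

include hmeas hnonneg hincome hwaiting in
/-- The reduced wealth moves at each claim by at most its size and a constant. -/
theorem abs_lineAfter_sub_le (hdeductible : ∀ i, 0 ≤ C.deductible i) {T : ℝ}
    (r y β : ℕ → ℝ) (n : ℕ) (q : ℝ × ℝ) (hq : q.1 ∈ Icc 0 (T + C.waiting)) (k : ℕ)
    (hr : ∀ j < k, r (n + j) ∈ Icc 0 T) :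
    (C.lineAfter r y β n q k).1 ∈ Icc 0 (T + C.waiting) ∧
    |(C.lineAfter r y β n q k).2 - q.2| ≤
      ∑ j ∈ Finset.range k, (|y (n + j)| + C.income * (T + C.waiting)) := by
  have hc := income_pos hnonneg hincome
  induction k with
  | zero => simpa [lineAfter] using hq
  | succ k ih =>
    obtain ⟨h1, h2⟩ := ih fun j hj => hr j (by omega)
    have hrk := hr k (by omega)
    rw [Finset.sum_range_succ]
    simp only [lineAfter]
    generalize C.lineAfter r y β n q k = p at h1 h2 ⊢
    have hTW : 0 ≤ T + C.waiting := hq.1.trans hq.2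
    have hpos : 0 ≤ C.income * (T + C.waiting) := by positivity
    have ha := abs_le.1 h2
    have hy := abs_le.1 (le_refl |y (n + k)|)
    unfold lineClaim
    split_ifs
    · refine ⟨h1, abs_le.2 ⟨?_, ?_⟩⟩ <;> simp only <;> linarith
    · refine ⟨⟨by simp only; linarith [hrk.1], by simp only; linarith [hrk.2]⟩, ?_⟩
      have hG := abs_lineGain_sub_le hmeas hnonneg hincome (-C.waiting) (r (n + k) - p.1)
      have hle : |r (n + k) - p.1 - -C.waiting| ≤ T + C.waiting := by
        rw [abs_le]
        constructor <;> linarith [hrk.1, hrk.2, h1.1, h1.2]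
      have hG' := abs_le.1 (hG.trans (mul_le_mul_of_nonneg_left hle hc.le))
      -- Holds for `y` of either sign because deductibles are nonnegative; the estimate is thus
      -- valid on every path.
      have hm : |min (y (n + k)) (C.deductible (lineClass (r (n + k) - p.1)))|
          ≤ |y (n + k)| := by
        have := hdeductible (lineClass (r (n + k) - p.1))
        rw [abs_le]
        rcases min_cases (y (n + k)) (C.deductible (lineClass (r (n + k) - p.1))) with
          ⟨e, _⟩ | ⟨e, _⟩ <;> rw [e] <;> constructor <;> linarith
      have hm' := abs_le.1 hm
      refine abs_le.2 ⟨?_, ?_⟩ <;> simp only <;> linarith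

end Gain

end Contract
/-! ### Claim times -/

section ClaimTimes

variable {Ω : Type*} {N : ℝ≥0 → Ω → ℕ} {j : ℕ} {u : ℝ≥0} {ω : Ω}

theorem claimTime_le (hj : j < N u ω) : claimTime N j ω ≤ u :=
  csInf_le (OrderBot.bddBelow _) hj

/-- The witness `v` excludes the default value `sInf ∅ = 0`. -/
theorem le_claimTime {v : ℝ≥0} (hmono : Monotone fun t => N t ω) (hu : N u ω ≤ j)
    (hv : j < N v ω) : u ≤ claimTime N j ω := by
  refine le_csInf ⟨v, hv⟩ fun a (ha : j < N a ω) => ?_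
  by_contra! hau
  have : N a ω ≤ N u ω := hmono hau.le
  omega

theorem lt_of_claimTime_lt {v : ℝ≥0} (hmono : Monotone fun t => N t ω) (hv : j < N v ω)
    (hu : claimTime N j ω < u) : j < N u ω := by
  obtain ⟨a, ha, hau⟩ := exists_lt_of_csInf_lt ⟨v, hv⟩ hu
  exact lt_of_lt_of_le ha (hmono hau.le)

theorem claimTime_mono {l : ℕ} (hjl : j ≤ l) (hl : l < N u ω) :
    claimTime N j ω ≤ claimTime N l ω :=
  csInf_le_csInf (OrderBot.bddBelow _) ⟨u, hl⟩ fun _ ha => lt_of_le_of_lt hjl ha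

theorem measurable_claimTime [MeasurableSpace Ω] (hN : ∀ t, Measurable (N t))
    (hmono : ∀ ω, Monotone fun t => N t ω) (j : ℕ) : Measurable (claimTime N j) := by
  refine measurable_of_Iio fun u => ?_
  have hlt : ∀ v, MeasurableSet {ω | j < N v ω} := fun v => hN v measurableSet_Ioi
  -- The second set collects the paths on which claim `j` never occurs; there the claim time has the
  -- default value 0.
  have heq : claimTime N j ⁻¹' Iio u =
      (⋃ a : ℚ, ⋃ _ : Real.toNNReal a < u, {ω | j < N (Real.toNNReal a) ω}) ∪
        ({_ω | 0 < u} ∩ ⋂ n : ℕ, {ω | j < N n ω}ᶜ) := by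
    ext ω
    simp only [mem_preimage, mem_Iio, mem_union, mem_iUnion, mem_inter_iff, mem_iInter,
      mem_compl_iff, mem_ofPred_eq, exists_prop]
    constructor
    · intro h
      by_cases hne : ∃ v, j < N v ω
      · obtain ⟨v, hv⟩ := hne
        obtain ⟨a, -, ha, hau⟩ := (NNReal.lt_iff_exists_rat_btwn _ _).1 h
        exact Or.inl ⟨a, hau, lt_of_claimTime_lt (hmono ω) hv ha⟩
      · push Not at hne
        exact Or.inr ⟨pos_of_gt h, fun n => (hne n).not_gt⟩
    · rintro (⟨a, hau, ha⟩ | ⟨hu, h⟩)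
      · exact (claimTime_le ha).trans_lt hau
      · have hempty : {v : ℝ≥0 | j < N v ω} = ∅ := by
          refine eq_empty_of_forall_notMem fun v hv => ?_
          obtain ⟨n, hn⟩ := exists_nat_ge v
          exact h n (lt_of_lt_of_le hv (hmono ω hn))
        rw [claimTime, hempty, NNReal.sInf_empty]
        exact hu
  rw [heq]
  exact (MeasurableSet.iUnion fun a => MeasurableSet.iUnion fun _ => hlt _).union
    ((MeasurableSet.const _).inter (MeasurableSet.iInter fun n => (hlt _).compl))

end ClaimTimes

/-! ### Sums over the claims of a period -/

/-- Since `(n + 1) / (n + 1)! = 1 / n!`, the series of the mean is `r` times the total mass. -/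
theorem lintegral_natCast_poissonMeasure (r : ℝ≥0) :
    ∫⁻ n, (n : ENNReal) ∂(poissonMeasure r) = r := by
  rw [lintegral_countable', tsum_eq_zero_add' ENNReal.summable]
  have hterm : ∀ n : ℕ, ((n + 1 : ℕ) : ENNReal) * poissonMeasure r {n + 1} =
      r * poissonMeasure r {n} := by
    intro n
    rw [poissonMeasure_singleton, poissonMeasure_singleton, ← ENNReal.ofReal_natCast,
      ← ENNReal.ofReal_coe_nnreal, ← ENNReal.ofReal_mul (by positivity),
      ← ENNReal.ofReal_mul (by positivity)]
    congr 1
    rw [Nat.factorial_succ]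
    push_cast
    field_simp
    ring
  simp_rw [hterm]
  rw [ENNReal.tsum_mul_left, ← measure_iUnion (fun a b hab => by simpa using hab)
    fun n => measurableSet_singleton n, iUnion_of_singleton, measure_univ]
  simp

section Model

variable {Ω : Type*} [MeasurableSpace Ω] {P : Measure Ω}
  {N : ℝ≥0 → Ω → ℕ} {Y : ℕ → Ω → ℝ} {rate : ℝ≥0}

theorem IsPoissonProcess.lintegral_sub (hN : IsPoissonProcess N rate P) {s t : ℝ≥0}
    (hst : s ≤ t) :
    ∫⁻ ω, ((N t ω - N s ω : ℕ) : ENNReal) ∂P = (rate * (t - s) : ℝ≥0) := by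
  rw [← lintegral_natCast_poissonMeasure, ← hN.law s t hst, lintegral_map (by fun_prop)]
  exact (measurable_of_countable fun p : ℕ × ℕ => p.1 - p.2).comp
    ((hN.measurable t).prodMk (hN.measurable s))

/-- The random sum is a series of indicators, functions of `N` alone, times `F (Y j)`. Independence
factors each term, and Tonelli sums the indicators to the number of claims. -/
theorem IsClaimModel.lintegral_sum_Ico (hM : IsClaimModel N Y rate P) {s t : ℝ≥0} (hst : s ≤ t)
    {F : ℝ → ENNReal} (hF : Measurable F) :
    ∫⁻ ω, ∑ j ∈ Finset.Ico (N s ω) (N t ω), F (Y j ω) ∂P =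
      (rate * (t - s) : ℝ≥0) * ∫⁻ ω, F (Y 0 ω) ∂P := by
  have hNm := hM.poisson.measurable
  let g : ℕ → ℕ × ℕ → ENNReal := fun j p => if j ∈ Finset.Ico p.1 p.2 then 1 else 0
  have hpair : Measurable fun ω => (N s ω, N t ω) := (hNm s).prodMk (hNm t)
  have hg : ∀ j, Measurable fun ω => g j (N s ω, N t ω) := fun j =>
    (measurable_of_countable (g j)).comp hpair
  have hFY : ∀ j, Measurable fun ω => F (Y j ω) := fun j => hF.comp (hM.measurable_size j)
  have hexp : ∀ (f : ℕ → ENNReal) ω, ∑ j ∈ Finset.Ico (N s ω) (N t ω), f j =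
      ∑' j, g j (N s ω, N t ω) * f j := by
    intro f ω
    rw [tsum_eq_sum (s := Finset.Ico (N s ω) (N t ω)) fun j hj => by simp only [g, hj]; simp]
    refine Finset.sum_congr rfl fun j hj => ?_
    simp only [g, hj]
    simp
  have hterm : ∀ j, ∫⁻ ω, g j (N s ω, N t ω) * F (Y j ω) ∂P =
      (∫⁻ ω, g j (N s ω, N t ω) ∂P) * ∫⁻ ω, F (Y 0 ω) ∂P := by
    intro j
    have hind : IndepFun (fun ω => g j (N s ω, N t ω)) (fun ω => F (Y j ω)) P :=
      (hM.indep.comp (φ := fun y : ℕ → ℝ => F (y j))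
        (ψ := fun n : ℝ≥0 → ℕ => g j (n s, n t)) (hF.comp (measurable_pi_apply j))
        ((measurable_of_countable (g j)).comp
          ((measurable_pi_apply s).prodMk (measurable_pi_apply t)))).symm
    rw [lintegral_mul_eq_lintegral_mul_lintegral_of_indepFun'' (hg j).aemeasurable
      (hFY j).aemeasurable hind]
    congr 1
    exact ((hM.identDistrib_size j).comp hF).lintegral_eq
  calc ∫⁻ ω, ∑ j ∈ Finset.Ico (N s ω) (N t ω), F (Y j ω) ∂P
      = ∑' j, ∫⁻ ω, g j (N s ω, N t ω) * F (Y j ω) ∂P := by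
        rw [lintegral_congr fun ω => hexp (fun j => F (Y j ω)) ω]
        exact lintegral_tsum fun j => ((hg j).mul (hFY j)).aemeasurable
    _ = (∫⁻ ω, ∑' j, g j (N s ω, N t ω) ∂P) * ∫⁻ ω, F (Y 0 ω) ∂P := by
        simp_rw [hterm]
        rw [ENNReal.tsum_mul_right, lintegral_tsum fun j => (hg j).aemeasurable]
    _ = _ := by
        rw [← hM.poisson.lintegral_sub hst]
        congr 1
        refine lintegral_congr fun ω => ?_
        have := hexp (fun _ => 1) ω
        simp only [mul_one] at this
        rw [← this]
        simp

theorem IsClaimModel.measurable_sum_Ico (hM : IsClaimModel N Y rate P) (s t : ℝ≥0)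
    {f : ℝ → ℝ} (hf : Measurable f) :
    Measurable fun ω => ∑ j ∈ Finset.Ico (N s ω) (N t ω), f (Y j ω) := by
  have h : Measurable fun p : Ω × ℕ × ℕ => ∑ j ∈ Finset.Ico p.2.1 p.2.2, f (Y j p.1) :=
    measurable_from_prod_countable_left fun n =>
      Finset.measurable_fun_sum (Finset.Ico n.1 n.2) fun j _ => hf.comp (hM.measurable_size j)
  exact h.comp (measurable_id.prodMk
    ((hM.poisson.measurable s).prodMk (hM.poisson.measurable t)))

/-- Wald's identity for the sum over the claims in `(s, t]`. -/
theorem IsClaimModel.integral_sum_Ico (hM : IsClaimModel N Y rate P) {s t : ℝ≥0} (hst : s ≤ t)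
    {f : ℝ → ℝ} (hf : Measurable f) (hf0 : ∀ y, 0 ≤ f y)
    (hint : Integrable (fun ω => f (Y 0 ω)) P) :
    Integrable (fun ω => ∑ j ∈ Finset.Ico (N s ω) (N t ω), f (Y j ω)) P ∧
    ∫ ω, ∑ j ∈ Finset.Ico (N s ω) (N t ω), f (Y j ω) ∂P =
      rate * (t - s) * ∫ ω, f (Y 0 ω) ∂P := by
  have hl := hM.lintegral_sum_Ico hst (F := fun y => ENNReal.ofReal (f y)) hf.ennreal_ofReal
  have hm := (hM.measurable_sum_Ico s t hf).aestronglyMeasurable (μ := P)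
  have hpos : ∀ ω, 0 ≤ ∑ j ∈ Finset.Ico (N s ω) (N t ω), f (Y j ω) := fun ω =>
    Finset.sum_nonneg fun j _ => hf0 _
  simp_rw [← ENNReal.ofReal_sum_of_nonneg fun j _ => hf0 _] at hl
  have hfin : ∫⁻ ω, ENNReal.ofReal (f (Y 0 ω)) ∂P ≠ ⊤ := by
    have := (hasFiniteIntegral_iff_ofReal (Filter.Eventually.of_forall fun ω => hf0 _)).1 hint.2
    exact this.ne
  constructor
  · refine ⟨hm, ?_⟩
    rw [hasFiniteIntegral_iff_ofReal (Filter.Eventually.of_forall hpos), hl]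
    exact ENNReal.mul_lt_top ENNReal.coe_lt_top hfin.lt_top
  · rw [integral_eq_lintegral_of_nonneg_ae (Filter.Eventually.of_forall hpos) hm, hl,
      integral_eq_lintegral_of_nonneg_ae (Filter.Eventually.of_forall fun ω => hf0 _) hint.1,
      ENNReal.toReal_mul, ENNReal.coe_toReal, NNReal.coe_mul, NNReal.coe_sub hst]

theorem IsClaimModel.integrable_size [IsProbabilityMeasure P] (hM : IsClaimModel N Y rate P) :
    Integrable (Y 0) P :=
  ((memLp_two_iff_integrable_sq (hM.measurable_size 0).aestronglyMeasurable).2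
    hM.secondMoment).integrable one_le_two

/-- Joint measurability, which allows a barrier to be evaluated at a random claim time, is all that
is needed of predictability. -/
theorem measurable_uncurry_of_mem_barrierStrategies {hM : IsClaimModel N Y rate P}
    {b : ℝ≥0 → Ω → ℝ≥0} (hb : b ∈ barrierStrategies hM) :
    Measurable (Function.uncurry b) := by
  have hle : (claimFiltration hM).predictable ≤ Prod.instMeasurableSpace :=
    measurableSpace_le_predictable_of_measurableSet
      (fun A hA => (measurableSet_singleton _).prod ((claimFiltration hM).le _ A hA))
      (fun i A hA => measurableSet_Ioi.prod ((claimFiltration hM).le _ A hA))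
  exact (StronglyMeasurable.mono hb hle).measurable

end Model

/-! ### Terminal wealth in straightened coordinates -/

namespace Contract

variable {Ω : Type*} {C : Contract} {N : ℝ≥0 → Ω → ℕ} {Y : ℕ → Ω → ℝ}

variable (C N Y) in
/-- The straightened coordinates after `k` claims, starting from `q` with claim number `n`. -/
noncomputable def linePath (b : ℝ≥0 → Ω → ℝ≥0) (n : ℕ) (q : ℝ × ℝ) (k : ℕ) (ω : Ω) : ℝ × ℝ :=
  C.lineAfter (fun j => claimTime N j ω) (fun j => Y j ω) (fun j => b (claimTime N j ω) ω) n q k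

variable (C N Y) in
/-- The terminal wealth of a policyholder with straightened coordinates `q` at time `t`. -/
noncomputable def lineWealth (T : ℝ≥0) (b : ℝ≥0 → Ω → ℝ≥0) (t : ℝ≥0) (q : ℝ × ℝ) (ω : Ω) : ℝ :=
  let p := C.linePath N Y b (N t ω) q (N T ω - N t ω) ω
  p.2 + C.lineGain (T - p.1)

variable (C) in
/-- The straightened coordinates of the state `(i, s, x)` at time `t`. -/
noncomputable def lineStart (i : InsClass) (t s x : ℝ) : ℝ × ℝ :=
  (t - C.lineCoord i s, x - C.lineGain (C.lineCoord i s))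

variable (hwaiting : 0 < C.waiting)
  (hmeas : ∀ i, Measurable fun s => C.premium i s (C.deductible i))
  (hnonneg : ∀ i s, 0 ≤ s → 0 ≤ C.premium i s (C.deductible i))
  (hincome : ∀ i s, 0 ≤ s → C.premium i s (C.deductible i) < C.income)

include hwaiting hmeas hnonneg hincome in
theorem terminalWealth_eq_lineWealth {ω : Ω} (hmono : Monotone fun t => N t ω)
    (b : ℝ≥0 → Ω → ℝ≥0) {t T : ℝ≥0} (ht : t ≤ T) {i : InsClass} {s : ℝ} (x : ℝ)
    (hs : 0 ≤ s) (hi : i = .C2 → s ≤ C.waiting) :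
    C.terminalWealth N Y T i t s x b ω = C.lineWealth N Y T b t (C.lineStart i t s x) ω := by
  have hNle : N t ω ≤ N T ω := hmono ht
  have hlast : (C.afterClaims (fun j => claimTime N j ω) (fun j => Y j ω) (fun v => b v ω) (N t ω)
      t ⟨i, s, x⟩ (N T ω - N t ω)).1 ≤ T := by
    cases hk : N T ω - N t ω with
    | zero => exact ht
    | succ k => exact claimTime_le (by omega)
  have h := (flow_afterClaims hwaiting hmeas hnonneg hincome (fun j => claimTime N j ω)
    (fun j => Y j ω) (fun v => b v ω) (N t ω) t x hs hi (N T ω - N t ω)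
    (fun j hj => le_claimTime (v := T) hmono (by omega) (by omega))
    (fun j hj => claimTime_mono (u := T) (by omega) (by omega)) T (by exact_mod_cast hlast)).1
  simp only [terminalWealth, controlledState, h, lineState_wealth]
  rfl

/-- The lower bound comes from `s ≤ t`, the upper one from `0 ≤ s` and `t ≤ T`. -/
theorem lineStart_mem_Icc (hwaiting : 0 < C.waiting) {T : ℝ≥0} {i : InsClass}
    {p : ℝ≥0 × ℝ × ℝ} (hp : p ∈ C.domain T i) :
    (C.lineStart i p.1 p.2.1 p.2.2).1 ∈ Icc (0 : ℝ) (T + C.waiting) := by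
  obtain ⟨h1, h2, h3, h4⟩ := hp
  have h3' : (p.1 : ℝ) ≤ T := h3
  cases i <;> simp only [lineStart, lineCoord] <;> constructor <;> linarith

section Measurability

variable [MeasurableSpace Ω]

include hmeas hnonneg hincome in
theorem measurable_lineClaim :
    Measurable fun a : ℝ × ℝ × ℝ × ℝ × ℝ => C.lineClaim a.1 a.2.1 a.2.2.1 a.2.2.2 := by
  have hG := measurable_lineGain hmeas hnonneg hincome
  have hm : Measurable fun σ : ℝ => C.deductible (lineClass σ) := by
    have : (fun σ : ℝ => C.deductible (lineClass σ)) =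
        fun σ => if σ < 0 then C.deductible .C2 else C.deductible .C1 := by
      funext σ
      exact apply_ite C.deductible _ _ _
    rw [this]
    exact Measurable.ite measurableSet_Iio measurable_const measurable_const
  have hσ : Measurable fun a : ℝ × ℝ × ℝ × ℝ × ℝ => a.1 - a.2.2.2.1 := by fun_prop
  have hG' := hG.comp hσ
  have hm' := hm.comp hσ
  simp only [Function.comp_def] at hG' hm'
  exact Measurable.ite (measurableSet_le (by fun_prop) (by fun_prop)) (by fun_prop)
    (by fun_prop)

include hmeas hnonneg hincome in
theorem measurable_linePath (hN : ∀ t, Measurable (N t)) (hmono : ∀ ω, Monotone fun t => N t ω)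
    (hY : ∀ j, Measurable (Y j)) {b : ℝ≥0 → Ω → ℝ≥0} (hb : Measurable (Function.uncurry b))
    (n : ℕ) (q : ℝ × ℝ) (k : ℕ) : Measurable (C.linePath N Y b n q k) := by
  induction k with
  | zero => exact measurable_const
  | succ k ih =>
    have hτ := measurable_claimTime hN hmono (n + k)
    have hβ : Measurable fun ω => b (claimTime N (n + k) ω) ω := hb.comp (hτ.prodMk measurable_id)
    exact (measurable_lineClaim hmeas hnonneg hincome).comp
      (hτ.coe_nnreal_real.prodMk ((hY (n + k)).prodMk (hβ.coe_nnreal_real.prodMk ih)))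

include hmeas hnonneg hincome in
theorem measurable_lineWealth (hN : ∀ t, Measurable (N t)) (hmono : ∀ ω, Monotone fun t => N t ω)
    (hY : ∀ j, Measurable (Y j)) {b : ℝ≥0 → Ω → ℝ≥0} (hb : Measurable (Function.uncurry b))
    (T t : ℝ≥0) (q : ℝ × ℝ) : Measurable (C.lineWealth N Y T b t q) := by
  have hpath : Measurable fun ω => C.linePath N Y b (N t ω) q (N T ω - N t ω) ω := by
    -- The random claim numbers take countably many values, so they may be frozen.
    have h : Measurable fun p : Ω × ℕ × ℕ => C.linePath N Y b p.2.1 q (p.2.2 - p.2.1) p.1 :=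
      measurable_from_prod_countable_left fun n =>
        measurable_linePath hmeas hnonneg hincome hN hmono hY hb n.1 q (n.2 - n.1)
    exact h.comp (measurable_id.prodMk ((hN t).prodMk (hN T)))
  exact hpath.snd.add
    ((measurable_lineGain hmeas hnonneg hincome).comp (measurable_const.sub hpath.fst))

end Measurability

/-! ### Pathwise comparison of terminal wealths -/

include hmeas hnonneg hincome in
/-- Terminal wealths of two policyholders observed from the same time. -/
theorem abs_lineWealth_sub_le (hdeductible : ∀ i, 0 ≤ C.deductible i) {κ : ℝ} (hκ : 0 ≤ κ)
    (T : ℝ≥0) (b : ℝ≥0 → Ω → ℝ≥0) (t : ℝ≥0) (q q' : ℝ × ℝ) (k : ℕ) (ω : Ω)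
    (hcross : ∀ j < k, ¬((claimTime N (N t ω + j) ω : ℝ) < q.1 ↔
      (claimTime N (N t ω + j) ω : ℝ) < q'.1) → 1 ≤ κ) :
    |((C.linePath N Y b (N t ω) q k ω).2 + C.lineGain (T - (C.linePath N Y b (N t ω) q k ω).1))
      - ((C.linePath N Y b (N t ω) q' k ω).2
        + C.lineGain (T - (C.linePath N Y b (N t ω) q' k ω).1))| ≤
      |q.2 - q'.2| + C.income * |q.1 - q'.1|
        + (C.deductible .C1 + C.deductible .C2) * κ := by
  refine le_trans ?_ (lineAfter_dist_le hmeas hnonneg hincome hdeductible hκ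
    (fun j => claimTime N j ω) (fun j => Y j ω) (fun j => b (claimTime N j ω) ω) (N t ω) q q' k
    hcross)
  change _ ≤ |(C.linePath N Y b (N t ω) q k ω).2 - (C.linePath N Y b (N t ω) q' k ω).2|
    + C.income * |(C.linePath N Y b (N t ω) q k ω).1 - (C.linePath N Y b (N t ω) q' k ω).1|
  generalize C.linePath N Y b (N t ω) q k ω = p
  generalize C.linePath N Y b (N t ω) q' k ω = p'
  have hG := abs_lineGain_sub_le hmeas hnonneg hincome (T - p'.1) (T - p.1)
  rw [show (T : ℝ) - p.1 - (T - p'.1) = -(p.1 - p'.1) by ring, abs_neg] at hG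
  refine le_trans ?_ (add_le_add_right hG _)
  refine le_trans (le_of_eq ?_) (abs_add_le _ _)
  congr 1
  ring

theorem mem_Icc_claimTime {T : ℝ≥0} {j : ℕ} {ω : Ω} (hj : j < N T ω) :
    (claimTime N j ω : ℝ) ∈ Icc (0 : ℝ) T :=
  ⟨NNReal.coe_nonneg _, NNReal.coe_le_coe.2 (claimTime_le hj)⟩

include hwaiting hmeas hnonneg hincome in
theorem abs_lineWealth_le (hdeductible : ∀ i, 0 ≤ C.deductible i) {ω : Ω}
    (hmono : Monotone fun t => N t ω) {T t : ℝ≥0} (ht : t ≤ T) (b : ℝ≥0 → Ω → ℝ≥0) {q : ℝ × ℝ}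
    (hq : q.1 ∈ Icc (0 : ℝ) (T + C.waiting)) :
    |C.lineWealth N Y T b t q ω| ≤ |q.2| + C.income * (T + C.waiting)
      + ∑ j ∈ Finset.Ico (N t ω) (N T ω), (|Y j ω| + C.income * (T + C.waiting)) := by
  have hNle : N t ω ≤ N T ω := hmono ht
  have hc := income_pos hnonneg hincome
  have h := abs_lineAfter_sub_le hwaiting hmeas hnonneg hincome hdeductible
    (fun j => claimTime N j ω) (fun j => Y j ω) (fun j => b (claimTime N j ω) ω) (N t ω) q hq
    (N T ω - N t ω) (fun j hj => mem_Icc_claimTime (by omega))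
  change (C.linePath N Y b (N t ω) q (N T ω - N t ω) ω).1 ∈ _ ∧
    |(C.linePath N Y b (N t ω) q (N T ω - N t ω) ω).2 - q.2| ≤ _ at h
  rw [Finset.sum_Ico_eq_sum_range]
  unfold lineWealth
  generalize C.linePath N Y b (N t ω) q (N T ω - N t ω) ω = p at h ⊢
  obtain ⟨⟨h1, h2⟩, h3⟩ := h
  have hG := abs_lineGain_sub_le hmeas hnonneg hincome 0 (T - p.1)
  rw [show C.lineGain 0 = 0 from intervalIntegral.integral_same, sub_zero, sub_zero] at hG
  have hle : |(T : ℝ) - p.1| ≤ T + C.waiting := by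
    rw [abs_le]
    constructor <;> linarith [NNReal.coe_nonneg T]
  have hG' := hG.trans (mul_le_mul_of_nonneg_left hle hc.le)
  calc |p.2 + C.lineGain (T - p.1)| = |q.2 + C.lineGain (T - p.1) + (p.2 - q.2)| := by
        congr 1
        ring
    _ ≤ |q.2| + |C.lineGain (T - p.1)| + |p.2 - q.2| := abs_add_three _ _ _
    _ ≤ _ := by gcongr

include hwaiting hmeas hnonneg hincome in
/-- Terminal wealths of two policyholders with the same coordinates, observed from different
times. -/
theorem abs_lineWealth_sub_le_of_le (hdeductible : ∀ i, 0 ≤ C.deductible i) {ω : Ω}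
    (hmono : Monotone fun t => N t ω) {T t t' : ℝ≥0} (htt' : t ≤ t') (ht' : t' ≤ T)
    (b : ℝ≥0 → Ω → ℝ≥0) {q : ℝ × ℝ} (hq : q.1 ∈ Icc (0 : ℝ) (T + C.waiting)) :
    |C.lineWealth N Y T b t q ω - C.lineWealth N Y T b t' q ω| ≤
      ∑ j ∈ Finset.Ico (N t ω) (N t' ω), (|Y j ω| + (2 * C.income * (T + C.waiting)
        + (C.deductible .C1 + C.deductible .C2))) := by
  have hc := income_pos hnonneg hincome
  have h1 := hdeductible .C1
  have h2 := hdeductible .C2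
  have hTW : 0 ≤ (T : ℝ) + C.waiting := by positivity
  have hle : N t ω ≤ N t' ω := hmono htt'
  have hle' : N t' ω ≤ N T ω := hmono ht'
  obtain ⟨k, hk⟩ := Nat.exists_eq_add_of_le hle
  have hsplit : C.linePath N Y b (N t ω) q (N T ω - N t ω) ω =
      C.linePath N Y b (N t' ω) (C.linePath N Y b (N t ω) q k ω) (N T ω - N t' ω) ω := by
    rw [hk, show N T ω - N t ω = k + (N T ω - (N t ω + k)) by omega]
    exact C.lineAfter_add _ _ _ _ _ _ _
  rcases Nat.eq_zero_or_pos k with rfl | hkpos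
  -- Without a claim in `(t, t']` the coordinates are conserved, and the wealths agree exactly.
  · have : C.lineWealth N Y T b t q ω = C.lineWealth N Y T b t' q ω := by
      unfold lineWealth
      rw [hsplit]
      rfl
    rw [this, sub_self, abs_zero]
    exact Finset.sum_nonneg fun j _ => by positivity
  obtain ⟨hA, hB⟩ := abs_lineAfter_sub_le hwaiting hmeas hnonneg hincome hdeductible
    (fun j => claimTime N j ω) (fun j => Y j ω) (fun j => b (claimTime N j ω) ω) (N t ω) q hq k
    (fun j hj => mem_Icc_claimTime (by omega))
  change (C.linePath N Y b (N t ω) q k ω).1 ∈ _ at hA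
  change |(C.linePath N Y b (N t ω) q k ω).2 - q.2| ≤ _ at hB
  -- From `t'` on, the displaced path is compared with one still at `q`. The crude choice `κ = 1`
  -- suffices, since at least one claim has occurred in `(t, t']` and can absorb the constant.
  have hD := abs_lineWealth_sub_le (N := N) (Y := Y) hmeas hnonneg hincome hdeductible zero_le_one T
    b t' (C.linePath N Y b (N t ω) q k ω) q (N T ω - N t' ω) ω fun _ _ _ => le_rfl
  have hθ : |(C.linePath N Y b (N t ω) q k ω).1 - q.1| ≤ T + C.waiting := by
    rw [abs_le]
    constructor <;> linarith [hA.1, hA.2, hq.1, hq.2]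
  unfold lineWealth
  simp only [hsplit]
  refine hD.trans ?_
  rw [Finset.sum_Ico_eq_sum_range, show N t' ω - N t ω = k by omega]
  have hsum : ∑ j ∈ Finset.range k, (|Y (N t ω + j) ω| + (2 * C.income * (T + C.waiting)
        + (C.deductible .C1 + C.deductible .C2))) =
      ∑ j ∈ Finset.range k, (|Y (N t ω + j) ω| + C.income * (T + C.waiting))
      + k * (C.income * (T + C.waiting) + (C.deductible .C1 + C.deductible .C2)) := by
    simp only [Finset.sum_add_distrib, Finset.sum_const, Finset.card_range, nsmul_eq_mul]
    ring
  rw [hsum, mul_one, add_assoc]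
  have hk1 : (1 : ℝ) ≤ k := by exact_mod_cast hkpos
  refine add_le_add hB (le_trans ?_ (le_mul_of_one_le_left (by positivity) hk1))
  gcongr

/-- A claim that finds two policyholders in different classes occurs shortly before the later one
of the two times at which their clock coordinates vanish. -/
theorem one_le_card_of_crossing {ω : Ω} (hmono : Monotone fun t => N t ω) (hzero : N 0 ω = 0)
    {T : ℝ≥0} {θ θ' : ℝ} {j : ℕ} (hj : j < N T ω)
    (hx : ¬((claimTime N j ω : ℝ) < θ ↔ (claimTime N j ω : ℝ) < θ')) :
    (1 : ℝ) ≤ ∑ _j ∈ Finset.Ico (N (min θ θ' - |θ - θ'|).toNNReal ω)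
      (N (max θ θ').toNNReal ω), (1 : ℝ) := by
  have hlt : (claimTime N j ω : ℝ) < max θ θ' ∧ min θ θ' ≤ claimTime N j ω ∧ 0 < |θ - θ'| := by
    rcases lt_or_ge (claimTime N j ω : ℝ) θ with h1 | h1 <;>
    rcases lt_or_ge (claimTime N j ω : ℝ) θ' with h2 | h2
    · exact absurd (iff_of_true h1 h2) hx
    · exact ⟨lt_max_of_lt_left h1, min_le_of_right_le h2, abs_pos.2 (by linarith)⟩
    · exact ⟨lt_max_of_lt_right h2, min_le_of_left_le h1, abs_pos.2 (by linarith)⟩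
    · exact absurd (iff_of_false h1.not_gt h2.not_gt) hx
  obtain ⟨h1, h2, h3⟩ := hlt
  have hup : j < N (max θ θ').toNNReal ω :=
    lt_of_claimTime_lt hmono hj (by rwa [Real.lt_toNNReal_iff_coe_lt])
  -- A claim exactly at `min θ θ'` is already counted by `N` there, so the left end is moved further
  -- left; this is the origin of the factor 2 in the length of the interval.
  have hlow : N (min θ θ' - |θ - θ'|).toNNReal ω ≤ j := by
    by_contra! hcon
    rcases le_or_gt (min θ θ' - |θ - θ'|) 0 with h0 | h0
    · rw [Real.toNNReal_of_nonpos h0, hzero] at hcon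
      omega
    · have := NNReal.coe_le_coe.2 (claimTime_le hcon)
      rw [Real.coe_toNNReal _ h0.le] at this
      linarith
  rw [Finset.sum_const, Nat.card_Ico, nsmul_eq_mul, mul_one]
  exact_mod_cast (by omega : 1 ≤ N (max θ θ').toNNReal ω - N (min θ θ' - |θ - θ'|).toNNReal ω)

end Contract

/-! ### Comparison of expectations -/

theorem abs_sSup_image_sub_le {α : Type*} {f g : α → ℝ} {S : Set α} {ε : ℝ} (hS : S.Nonempty)
    (hf : BddAbove (f '' S)) (hg : BddAbove (g '' S)) (h : ∀ a ∈ S, |f a - g a| ≤ ε) :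
    |sSup (f '' S) - sSup (g '' S)| ≤ ε := by
  have h1 : sSup (f '' S) ≤ sSup (g '' S) + ε := by
    refine csSup_le (hS.image f) ?_
    rintro _ ⟨a, ha, rfl⟩
    linarith [(abs_le.1 (h a ha)).2, le_csSup hg (mem_image_of_mem g ha)]
  have h2 : sSup (g '' S) ≤ sSup (f '' S) + ε := by
    refine csSup_le (hS.image g) ?_
    rintro _ ⟨a, ha, rfl⟩
    linarith [(abs_le.1 (h a ha)).1, le_csSup hf (mem_image_of_mem f ha)]
  rw [abs_le]
  constructor <;> linarith

namespace Contract

variable {Ω : Type*} [MeasurableSpace Ω] {P : Measure Ω}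
  {C : Contract} {N : ℝ≥0 → Ω → ℕ} {Y : ℕ → Ω → ℝ} {rate : ℝ≥0} {h : ℝ → ℝ} {L : ℝ≥0}

variable (hwaiting : 0 < C.waiting) (hdeductible : ∀ i, 0 ≤ C.deductible i)
  (hmeas : ∀ i, Measurable fun s => C.premium i s (C.deductible i))
  (hnonneg : ∀ i s, 0 ≤ s → 0 ≤ C.premium i s (C.deductible i))
  (hincome : ∀ i s, 0 ≤ s → C.premium i s (C.deductible i) < C.income)
  (hh : LipschitzWith L h)

theorem barrierStrategies_nonempty (hM : IsClaimModel N Y rate P) :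
    (barrierStrategies hM).Nonempty :=
  ⟨fun _ _ => 0, stronglyMeasurable_const⟩

include hwaiting hmeas hnonneg hincome in
theorem terminalWealth_eq_of_mem_domain (hM : IsClaimModel N Y rate P) {T : ℝ≥0} {i : InsClass}
    {p : ℝ≥0 × ℝ × ℝ} (hp : p ∈ C.domain T i)
    (b : ℝ≥0 → Ω → ℝ≥0) :
    C.terminalWealth N Y T i p.1 p.2.1 p.2.2 b =
      C.lineWealth N Y T b p.1 (C.lineStart i p.1 p.2.1 p.2.2) :=
  funext fun ω => terminalWealth_eq_lineWealth hwaiting hmeas hnonneg hincome (hM.poisson.mono ω) b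
    hp.2.2.1 _ hp.1 hp.2.2.2

variable [IsProbabilityMeasure P]

theorem integral_abs_size_add (hM : IsClaimModel N Y rate P) {s t : ℝ≥0} (hst : s ≤ t) {a : ℝ}
    (ha : 0 ≤ a) :
    Integrable (fun ω => ∑ j ∈ Finset.Ico (N s ω) (N t ω), (|Y j ω| + a)) P ∧
    ∫ ω, ∑ j ∈ Finset.Ico (N s ω) (N t ω), (|Y j ω| + a) ∂P =
      rate * (t - s) * ∫ ω, (|Y 0 ω| + a) ∂P :=
  hM.integral_sum_Ico hst (f := fun y => |y| + a) (by fun_prop) (fun y => by positivity)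
    (hM.integrable_size.abs.add (integrable_const a))

include hwaiting hdeductible hmeas hnonneg hincome hh in
theorem integrable_lineWealth (hM : IsClaimModel N Y rate P) {T t : ℝ≥0} (ht : t ≤ T)
    {q : ℝ × ℝ} (hq : q.1 ∈ Icc (0 : ℝ) (T + C.waiting)) :
    ∃ B : ℝ, ∀ b ∈ barrierStrategies hM,
      Integrable (fun ω => h (C.lineWealth N Y T b t q ω)) P ∧
      ∫ ω, h (C.lineWealth N Y T b t q ω) ∂P ≤ B := by
  have hc := income_pos hnonneg hincome
  have hK : 0 ≤ C.income * (T + C.waiting) := by positivity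
  obtain ⟨hS, -⟩ := integral_abs_size_add hM ht hK
  -- The dominating function does not involve the strategy, so it also bounds the supremum.
  let g : Ω → ℝ := fun ω => |h 0| + L * (|q.2| + C.income * (T + C.waiting)
    + ∑ j ∈ Finset.Ico (N t ω) (N T ω), (|Y j ω| + C.income * (T + C.waiting)))
  have hg : Integrable g P :=
    (integrable_const _).add (((integrable_const _).add hS).const_mul _)
  refine ⟨∫ ω, g ω ∂P, fun b hb => ?_⟩
  have hbound : ∀ ω, |h (C.lineWealth N Y T b t q ω)| ≤ g ω := by
    intro ω
    have h1 := hh.dist_le_mul (C.lineWealth N Y T b t q ω) 0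
    rw [Real.dist_eq, Real.dist_eq, sub_zero] at h1
    have h2 := abs_lineWealth_le (Y := Y) hwaiting hmeas hnonneg hincome hdeductible
      (hM.poisson.mono ω) ht b hq
    have h3 := abs_sub_abs_le_abs_sub (h (C.lineWealth N Y T b t q ω)) (h 0)
    have h4 := mul_le_mul_of_nonneg_left h2 (NNReal.coe_nonneg L)
    simp only [g]
    linarith
  have hint : Integrable (fun ω => h (C.lineWealth N Y T b t q ω)) P :=
    hg.mono' (hh.continuous.measurable.comp (measurable_lineWealth hmeas hnonneg hincome
      hM.poisson.measurable hM.poisson.mono hM.measurable_size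
      (measurable_uncurry_of_mem_barrierStrategies hb) T t q)).aestronglyMeasurable
      (Filter.Eventually.of_forall hbound)
  exact ⟨hint, integral_mono hint hg fun ω => (le_abs_self _).trans (hbound ω)⟩

include hwaiting hdeductible hmeas hnonneg hincome hh in
/-- The effect of the initial time and the initial coordinates on the expected utility, under one
and the same barrier strategy. -/
theorem abs_integral_lineWealth_sub_le (hM : IsClaimModel N Y rate P) {T t t' : ℝ≥0}
    (htt' : t ≤ t') (ht' : t' ≤ T) {q q' : ℝ × ℝ} (hq : q.1 ∈ Icc (0 : ℝ) (T + C.waiting))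
    (hq' : q'.1 ∈ Icc (0 : ℝ) (T + C.waiting)) {b : ℝ≥0 → Ω → ℝ≥0}
    (hb : b ∈ barrierStrategies hM) :
    |∫ ω, h (C.lineWealth N Y T b t q ω) ∂P - ∫ ω, h (C.lineWealth N Y T b t' q' ω) ∂P| ≤
      L * (|q.2 - q'.2| + C.income * |q.1 - q'.1|
        + (C.deductible .C1 + C.deductible .C2) * (rate * (2 * |q.1 - q'.1|))
        + rate * (t' - t) * ∫ ω, (|Y 0 ω| + (2 * C.income * (T + C.waiting)
          + (C.deductible .C1 + C.deductible .C2))) ∂P) := by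
  have hc := income_pos hnonneg hincome
  have hd1 := hdeductible .C1
  have hd2 := hdeductible .C2
  set D := C.deductible .C1 + C.deductible .C2 with hD
  have hD0 : 0 ≤ D := by positivity
  set a := 2 * C.income * (T + C.waiting) + D with ha
  have ha0 : 0 ≤ a := by positivity
  set u := (min q.1 q'.1 - |q.1 - q'.1|).toNNReal with hu
  set e := (max q.1 q'.1).toNNReal with he
  have hue : u ≤ e := by
    refine Real.toNNReal_le_toNNReal ?_
    linarith [abs_nonneg (q.1 - q'.1), min_le_max (a := q.1) (b := q'.1)]
  obtain ⟨hS, hS'⟩ := integral_abs_size_add hM htt' ha0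
  obtain ⟨hκ, hκ'⟩ := hM.integral_sum_Ico hue (f := fun _ => 1) measurable_const
    (fun _ => zero_le_one) (integrable_const 1)
  obtain ⟨_, hI⟩ := integrable_lineWealth hwaiting hdeductible hmeas hnonneg hincome hh hM
    (htt'.trans ht') hq
  obtain ⟨_, hI'⟩ := integrable_lineWealth hwaiting hdeductible hmeas hnonneg hincome hh hM ht' hq'
  rw [← integral_sub (hI b hb).1 (hI' b hb).1]
  have hpath : ∀ ω, ‖h (C.lineWealth N Y T b t q ω) - h (C.lineWealth N Y T b t' q' ω)‖ ≤
      L * (|q.2 - q'.2| + C.income * |q.1 - q'.1|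
        + D * ∑ _j ∈ Finset.Ico (N u ω) (N e ω), (1 : ℝ)
        + ∑ j ∈ Finset.Ico (N t ω) (N t' ω), (|Y j ω| + a)) := by
    intro ω
    refine (hh.norm_sub_le _ _).trans (mul_le_mul_of_nonneg_left ?_ (NNReal.coe_nonneg L))
    -- The intermediate path starts from `q` at time `t'`: first the time changes, then the
    -- coordinates, with `κ` the random number of claims in `(u, e]`.
    have h1 := abs_lineWealth_sub_le_of_le (Y := Y) hwaiting hmeas hnonneg hincome hdeductible
      (hM.poisson.mono ω) htt' ht' b hq
    have h2 := abs_lineWealth_sub_le (N := N) (Y := Y) hmeas hnonneg hincome hdeductible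
      (κ := ∑ _j ∈ Finset.Ico (N u ω) (N e ω), (1 : ℝ))
      (Finset.sum_nonneg fun _ _ => zero_le_one) T b t' q q' (N T ω - N t' ω) ω
      (fun j hj hx => one_le_card_of_crossing (hM.poisson.mono ω) (hM.poisson.zero ω)
        (T := T) (by omega) hx)
    have h3 := abs_sub_le (C.lineWealth N Y T b t q ω) (C.lineWealth N Y T b t' q ω)
      (C.lineWealth N Y T b t' q' ω)
    rw [Real.norm_eq_abs]
    refine h3.trans ((add_le_add h1 h2).trans (le_of_eq ?_))
    ring
  have hint1 : Integrable (fun ω => |q.2 - q'.2| + C.income * |q.1 - q'.1|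
      + D * ∑ _j ∈ Finset.Ico (N u ω) (N e ω), (1 : ℝ)) P :=
    (integrable_const _).add (hκ.const_mul D)
  refine (norm_integral_le_of_norm_le ((hint1.add hS).const_mul (L : ℝ))
    (Filter.Eventually.of_forall hpath)).trans ?_
  simp only [Pi.add_apply]
  rw [integral_const_mul, integral_add hint1 hS, integral_add (integrable_const _) (hκ.const_mul D),
    integral_const_mul, hκ', hS']
  simp only [integral_const, probReal_univ, smul_eq_mul, one_mul, mul_one]
  -- Truncation at 0 leaves the right end unchanged and can only raise the left one.
  have hlen : (e : ℝ) - u ≤ 2 * |q.1 - q'.1| := by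
    rw [he, hu, Real.coe_toNNReal _ (le_max_of_le_left hq.1)]
    have h1 := Real.le_coe_toNNReal (min q.1 q'.1 - |q.1 - q'.1|)
    have h2 := max_sub_min_eq_abs q.1 q'.1
    rw [abs_sub_comm] at h2
    linarith
  gcongr

/-! ### Finiteness and Lipschitz continuity of the value function -/

variable {hM : IsClaimModel N Y rate P} {T : ℝ≥0} {i : InsClass} {p p' : ℝ≥0 × ℝ × ℝ}

include hwaiting hdeductible hmeas hnonneg hincome hh in
theorem integrable_terminalWealth (hp : p ∈ C.domain T i) {b : ℝ≥0 → Ω → ℝ≥0}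
    (hb : b ∈ barrierStrategies hM) :
    Integrable (fun ω => h (C.terminalWealth N Y T i p.1 p.2.1 p.2.2 b ω)) P := by
  rw [terminalWealth_eq_of_mem_domain hwaiting hmeas hnonneg hincome hM hp]
  obtain ⟨_, hI⟩ := integrable_lineWealth hwaiting hdeductible hmeas hnonneg hincome hh hM
    hp.2.2.1 (lineStart_mem_Icc hwaiting hp)
  exact (hI b hb).1

include hwaiting hdeductible hmeas hnonneg hincome hh in
theorem bddAbove_payoff (hp : p ∈ C.domain T i) :
    BddAbove (C.payoff P N Y T h i p.1 p.2.1 p.2.2 '' barrierStrategies hM) := by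
  obtain ⟨B, hB⟩ := integrable_lineWealth hwaiting hdeductible hmeas hnonneg hincome hh hM
    hp.2.2.1 (lineStart_mem_Icc hwaiting hp)
  refine ⟨B, ?_⟩
  rintro _ ⟨b, hb, rfl⟩
  rw [payoff, terminalWealth_eq_of_mem_domain hwaiting hmeas hnonneg hincome hM hp]
  exact (hB b hb).2

include hwaiting hdeductible hmeas hnonneg hincome hh in
theorem abs_value_sub_le (hp : p ∈ C.domain T i) (hp' : p' ∈ C.domain T i) (hle : p.1 ≤ p'.1) :
    |C.value hM T h i p.1 p.2.1 p.2.2 - C.value hM T h i p'.1 p'.2.1 p'.2.2| ≤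
      L * (1 + 3 * C.income + 4 * rate * (C.deductible .C1 + C.deductible .C2)
        + rate * ∫ ω, (|Y 0 ω| + (2 * C.income * (T + C.waiting)
          + (C.deductible .C1 + C.deductible .C2))) ∂P) * dist p p' := by
  refine abs_sSup_image_sub_le (barrierStrategies_nonempty hM)
    (bddAbove_payoff hwaiting hdeductible hmeas hnonneg hincome hh hp)
    (bddAbove_payoff hwaiting hdeductible hmeas hnonneg hincome hh hp') fun b hb => ?_
  rw [payoff, payoff, terminalWealth_eq_of_mem_domain hwaiting hmeas hnonneg hincome hM hp,
    terminalWealth_eq_of_mem_domain hwaiting hmeas hnonneg hincome hM hp']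
  refine (abs_integral_lineWealth_sub_le hwaiting hdeductible hmeas hnonneg hincome hh hM hle
    hp'.2.2.1 (lineStart_mem_Icc hwaiting hp) (lineStart_mem_Icc hwaiting hp') hb).trans ?_
  have hc := income_pos hnonneg hincome
  have hd1 := hdeductible .C1
  have hd2 := hdeductible .C2
  set D := C.deductible .C1 + C.deductible .C2 with hD
  have hE : 0 ≤ ∫ ω, (|Y 0 ω| + (2 * C.income * (T + C.waiting) + D)) ∂P :=
    integral_nonneg fun ω => by positivity
  generalize ∫ ω, (|Y 0 ω| + (2 * C.income * (T + C.waiting) + D)) ∂P = E at hE ⊢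
  set δ := dist p p' with hδ
  have ht : |(p.1 : ℝ) - p'.1| ≤ δ := by
    rw [← NNReal.dist_eq]
    exact le_max_left _ _
  have hs : |p.2.1 - p'.2.1| ≤ δ := by
    rw [← Real.dist_eq]
    exact (le_max_left _ _).trans (le_max_right _ _)
  have hx : |p.2.2 - p'.2.2| ≤ δ := by
    rw [← Real.dist_eq]
    exact (le_max_right _ _).trans (le_max_right _ _)
  have hcoord : C.lineCoord i p.2.1 - C.lineCoord i p'.2.1 = p.2.1 - p'.2.1 := by
    cases i <;> simp [lineCoord]
  -- This coordinate varies with both time and clock, each of which moves by at most `δ` in the sup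
  -- metric.
  have hθ : |(C.lineStart i p.1 p.2.1 p.2.2).1 - (C.lineStart i p'.1 p'.2.1 p'.2.2).1| ≤ 2 * δ := by
    simp only [lineStart]
    rw [show (p.1 : ℝ) - C.lineCoord i p.2.1 - (p'.1 - C.lineCoord i p'.2.1) =
      (p.1 - p'.1) - (p.2.1 - p'.2.1) by linarith]
    exact (abs_sub _ _).trans (by linarith)
  have hw : |(C.lineStart i p.1 p.2.1 p.2.2).2 - (C.lineStart i p'.1 p'.2.1 p'.2.2).2| ≤
      δ + C.income * δ := by
    have hG := abs_lineGain_sub_le hmeas hnonneg hincome (C.lineCoord i p'.2.1)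
      (C.lineCoord i p.2.1)
    rw [hcoord] at hG
    simp only [lineStart]
    rw [show p.2.2 - C.lineGain (C.lineCoord i p.2.1)
        - (p'.2.2 - C.lineGain (C.lineCoord i p'.2.1)) =
      (p.2.2 - p'.2.2) - (C.lineGain (C.lineCoord i p.2.1)
        - C.lineGain (C.lineCoord i p'.2.1)) by ring]
    exact (abs_sub _ _).trans (add_le_add hx (hG.trans (mul_le_mul_of_nonneg_left hs hc.le)))
  have ht' : (p'.1 : ℝ) - p.1 ≤ δ := by linarith [neg_abs_le ((p.1 : ℝ) - p'.1)]
  calc _ ≤ L * (δ + C.income * δ + C.income * (2 * δ) + D * (rate * (2 * (2 * δ)))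
        + rate * δ * E) := by gcongr
    _ = _ := by ring

end Contract

end BonusMalus

theorem mainTheorem3 {Ω : Type*} [MeasurableSpace Ω] (P : Measure Ω) [IsProbabilityMeasure P]
    (N : ℝ≥0 → Ω → ℕ) (Y : ℕ → Ω → ℝ) (rate : ℝ≥0) (hrate : 0 < rate)
    (hM : BonusMalus.IsClaimModel N Y rate P)
    (T : ℝ≥0) (hT : 0 < T)
    (C : BonusMalus.Contract)
    (hwaiting : 0 < C.waiting)
    (hdeductible : ∀ i, 0 ≤ C.deductible i)
    (hmeas : ∀ i, Measurable fun s => C.premium i s (C.deductible i))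
    (hnonneg : ∀ i s, 0 ≤ s → 0 ≤ C.premium i s (C.deductible i))
    (hincome : ∀ i s, 0 ≤ s → C.premium i s (C.deductible i) < C.income)
    (h : ℝ → ℝ) (L : ℝ≥0) (hh : LipschitzWith L h) :
    -- the value function is well defined and finite
    (∀ i, ∀ p ∈ C.domain T i,
      (∀ b ∈ BonusMalus.barrierStrategies hM,
        Integrable (fun ω => h (C.terminalWealth N Y T i p.1 p.2.1 p.2.2 b ω)) P) ∧
      (C.payoff P N Y T h i p.1 p.2.1 p.2.2 '' BonusMalus.barrierStrategies hM).Nonempty ∧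
      BddAbove (C.payoff P N Y T h i p.1 p.2.1 p.2.2 '' BonusMalus.barrierStrategies hM)) ∧
    -- and Lipschitz continuous jointly in time, time since the last report, and wealth
    ∀ i, ∃ K : ℝ≥0, LipschitzOnWith K
      (fun p : ℝ≥0 × ℝ × ℝ => C.value hM T h i p.1 p.2.1 p.2.2) (C.domain T i) := by
  refine ⟨fun i p hp => ⟨fun b hb => ?_, ?_, ?_⟩, fun i => ?_⟩
  · exact BonusMalus.Contract.integrable_terminalWealth hwaiting hdeductible hmeas hnonneg hincome
      hh hp hb
  · exact (BonusMalus.Contract.barrierStrategies_nonempty hM).image _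
  · exact BonusMalus.Contract.bddAbove_payoff hwaiting hdeductible hmeas hnonneg hincome hh hp
  · refine ⟨Real.toNNReal (L * (1 + 3 * C.income
      + 4 * rate * (C.deductible .C1 + C.deductible .C2)
      + rate * ∫ ω, (|Y 0 ω| + (2 * C.income * (T + C.waiting)
        + (C.deductible .C1 + C.deductible .C2))) ∂P)), LipschitzOnWith.of_dist_le_mul fun p hp p' hp' => ?_⟩
    rw [Real.dist_eq]
    -- A real number is at most its `toNNReal` whatever its sign, so the constant need not be shown
    -- nonnegative.
    refine le_trans ?_ (mul_le_mul_of_nonneg_right (Real.le_coe_toNNReal _) dist_nonneg)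
    rcases le_total p.1 p'.1 with hle | hle
    · exact BonusMalus.Contract.abs_value_sub_le hwaiting hdeductible hmeas hnonneg hincome hh
        hp hp' hle
    · rw [abs_sub_comm, dist_comm]
      exact BonusMalus.Contract.abs_value_sub_le hwaiting hdeductible hmeas hnonneg hincome hh
        hp' hp hle
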